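/- Fix formulas built from countably many atoms $p_0,p_1,\dots$ by $\wedge$, $\vee$, $-$ and the constants $\top$, $\bot$. A \emph{logic} is a relation $\vdash$ between sets of formulas and formulas that is reflexive ($\varphi\vdash\varphi$), monotone, closed under cut (if $\Gamma\vdash\varphi$ for all $\varphi\in\Phi$ and $\Phi,\Delta\vdash\psi$, then $\Gamma,\Delta\vdash\psi$) and closed under substitutions; it is \emph{finitary} if $\Gamma\vdash\varphi$ implies $\Gamma'\vdash\varphi$ for some finite $\Gamma'\subseteq\Gamma$. The Dunn--Belnap logic $\mathcal B$ is the logic of the matrix $\mathbf{B}_4$: the four-element diamond lattice with the negation that exchanges top and bottom and fixes the two intermediate elements, where the designated values are the top and one of the two intermediate elements; that is, $\Gamma\vdash_{\mathcal B}\varphi$ iff every valuation in $\mathbf{B}_4$ that designates all of $\Gamma$ designates $\varphi$. A \emph{super-Belnap logic} is a logic extending $\mathcal B$. A logic $\mathcal L$ \emph{has interpolation} if whenever $\varphi\vdash_{\mathcal L}\psi$ for formulas $\varphi,\psi$, there is a formula $\chi$ with $\varphi\vdash_{\mathcal L}\chi$ and $\chi\vdash_{\mathcal L}\psi$ such that every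 atom occurring in $\chi$ occurs in both $\varphi$ and $\psi$. Then there are continuum many (that is, at least $2^{\aleph_0}$) super-Belnap logics with interpolation and continuum many super-Belnap logics without interpolation. Moreover, the set of finitary super-Belnap logics with interpolation and the set of finitary super-Belnap logics without interpolation both have cardinality exactly $2^{\aleph_0}$. -/

import Mathlib

namespace SuperBelnap

/-- Formulas over countably many atoms `p₀, p₁, …`, in the signature with conjunction, disjunction,
De Morgan negation and the two truth constants. -/
inductive Fm : Type
  | atom : ℕ → Fm
  | top : Fm
  | bot : Fm
  | neg : Fm → Fm
  | and : Fm → Fm → Fm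
  | or : Fm → Fm → Fm

namespace Fm

/-- The set of atoms (propositional variables) occurring in a formula. -/
def atoms : Fm → Set ℕ
  | atom n => {n}
  | top => ∅
  | bot => ∅
  | neg φ => φ.atoms
  | and φ ψ => φ.atoms ∪ ψ.atoms
  | or φ ψ => φ.atoms ∪ ψ.atoms

/-- The (homomorphic) action of a substitution on formulas. -/
def subst (σ : ℕ → Fm) : Fm → Fm
  | atom n => σ n
  | top => top
  | bot => bot
  | neg φ => neg (φ.subst σ)
  | and φ ψ => and (φ.subst σ) (ψ.subst σ)
  | or φ ψ => or (φ.subst σ) (ψ.subst σ)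

end Fm

/-- A logic: a reflexive, monotone, structural relation between sets of formulas and formulas
that is closed under cut. It need not be finitary. -/
@[ext]
structure Logic : Type where
  /-- `L.Entails Γ φ` is the consequence `Γ ⊢ φ` of `L`. -/
  Entails : Set Fm → Fm → Prop
  refl : ∀ φ : Fm, Entails {φ} φ
  mono : ∀ (Γ Δ : Set Fm) (φ : Fm), Entails Γ φ → Entails (Γ ∪ Δ) φ
  cut : ∀ (Γ Δ Φ : Set Fm) (ψ : Fm),
    (∀ φ ∈ Φ, Entails Γ φ) → Entails (Φ ∪ Δ) ψ → Entails (Γ ∪ Δ) ψ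
  structural : ∀ (Γ : Set Fm) (φ : Fm) (σ : ℕ → Fm),
    Entails Γ φ → Entails (Fm.subst σ '' Γ) (φ.subst σ)

/-- A logical matrix: an algebra in the signature of `Fm` with a set of designated elements. -/
structure LogicalMatrix : Type 1 where
  Carrier : Type
  top : Carrier
  bot : Carrier
  neg : Carrier → Carrier
  and : Carrier → Carrier → Carrier
  or : Carrier → Carrier → Carrier
  designated : Set Carrier

namespace LogicalMatrix

/-- The valuation (homomorphism from the formula algebra) extending `v`. -/
def eval (M : LogicalMatrix) (v : ℕ → M.Carrier) : Fm → M.Carrier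
  | .atom n => v n
  | .top => M.top
  | .bot => M.bot
  | .neg φ => M.neg (M.eval v φ)
  | .and φ ψ => M.and (M.eval v φ) (M.eval v ψ)
  | .or φ ψ => M.or (M.eval v φ) (M.eval v ψ)

theorem eval_subst (M : LogicalMatrix) (v : ℕ → M.Carrier) (σ : ℕ → Fm) (φ : Fm) :
    M.eval v (φ.subst σ) = M.eval (fun n => M.eval v (σ n)) φ := by
  induction φ with
  | atom n => rfl
  | top => rfl
  | bot => rfl
  | neg φ ih => simp only [Fm.subst, eval, ih]
  | and φ ψ ih₁ ih₂ => simp only [Fm.subst, eval, ih₁, ih₂]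
  | or φ ψ ih₁ ih₂ => simp only [Fm.subst, eval, ih₁, ih₂]

/-- The logic of a matrix: preservation of designation under every valuation. -/
def log (M : LogicalMatrix) : Logic where
  Entails Γ φ := ∀ v : ℕ → M.Carrier,
    (∀ γ ∈ Γ, M.eval v γ ∈ M.designated) → M.eval v φ ∈ M.designated
  refl φ v h := h φ rfl
  mono Γ Δ φ h v hv := h v fun γ hγ => hv γ (Or.inl hγ)
  cut Γ Δ Φ ψ h₁ h₂ v hv := h₂ v fun γ hγ => hγ.elim
    (fun hΦ => h₁ γ hΦ v fun δ hδ => hv δ (Or.inl hδ)) (fun hΔ => hv γ (Or.inr hΔ))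
  structural Γ φ σ h v hv := by
    rw [eval_subst]
    refine h _ fun γ hγ => ?_
    rw [← eval_subst]
    exact hv _ ⟨γ, hγ, rfl⟩

end LogicalMatrix

/-- The matrix `B₄`: the four-element diamond lattice `Bool × Bool` (componentwise order), whose
negation swaps the top and the bottom and fixes the two incomparable elements `(true, false)` and
`(false, true)`. The designated elements are the top and one of the incomparable elements. -/
def matrixB4 : LogicalMatrix where
  Carrier := Bool × Bool
  top := ⊤
  bot := ⊥
  neg a := (!a.2, !a.1)
  and a b := a ⊓ b
  or a b := a ⊔ b
  designated := {(true, true), (true, false)}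

/-- The four-valued Dunn–Belnap logic. -/
def logicB : Logic := matrixB4.log

namespace Logic

/-- `L₂` is an extension of `L₁`. -/
def IsExtension (L₁ L₂ : Logic) : Prop :=
  ∀ (Γ : Set Fm) (φ : Fm), L₁.Entails Γ φ → L₂.Entails Γ φ

/-- A super-Belnap logic is an extension of the Dunn–Belnap logic. -/
def IsSuperBelnap (L : Logic) : Prop := logicB.IsExtension L

/-- A logic is finitary if every consequence already follows from finitely many premises. -/
def IsFinitary (L : Logic) : Prop :=
  ∀ (Γ : Set Fm) (φ : Fm), L.Entails Γ φ → ∃ Γ' ⊆ Γ, Γ'.Finite ∧ L.Entails Γ' φ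

/-- The (simple) Craig interpolation property. -/
def HasInterpolation (L : Logic) : Prop :=
  ∀ φ ψ : Fm, L.Entails {φ} ψ →
    ∃ χ : Fm, L.Entails {φ} χ ∧ L.Entails {χ} ψ ∧ χ.atoms ⊆ φ.atoms ∩ ψ.atoms

end Logic

end SuperBelnap

/-! Both families of logics are indexed by sets of finite graphs. Each graph `G` gets a formula
`graphFm G` such that `graphFm G` entails a substitution instance of `graphFm H` in `logicB` only if
there is a homomorphism from `G` to `H` (`nonempty_hom_of_entails`). Given an infinite antichain of
graphs in the homomorphism order, distinct subsets of it yield distinct sets of explosive rules,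
hence continuum many logics (`mem_iff_entails`). The antichain comes from shift graphs, whose
chromatic number and odd girth can both be made arbitrarily large.

If explosive premises entail everything, interpolation survives: `logicB` interpolates, and every
additional consequence has the interpolant `⊥`. If explosive premises entail only what follows from
them with excluded middle, interpolation fails: `graphFm G` entails `p ∨ -p` for a fresh `p`, but an
interpolant would be constantly true or constantly false, and neither is possible.

The upper bound holds because a finitary logic is determined by its consequences from finite sets of
formulas, of which there are countably many. -/

namespace SuperBelnap

/-! ### Shift graphs and an infinite homomorphism antichain of finite graphs -/

/-- The shift graph: its vertices are the strictly increasing `k`-tuples in `Fin N`, and two of them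
are adjacent if one arises from the other by dropping the first entry and appending a new one. -/
def shiftGraph (k N : ℕ) : SimpleGraph {u : Fin k → Fin N // StrictMono u} :=
  SimpleGraph.fromRel fun u v => ∀ i j : Fin k, (j : ℕ) = i + 1 → v.1 i = u.1 j

/-- Along a walk, the entries far enough from the ends of the tuple are merely translated. -/
theorem shiftGraph_walk_translates {k N : ℕ} {u v : {u : Fin k → Fin N // StrictMono u}}
    (w : (shiftGraph k N).Walk u v) :
    ∃ d : ℤ, |d| ≤ w.length ∧ Even (d - w.length) ∧ ∀ i j : Fin k, (j : ℤ) = i + d →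
      w.length ≤ i → i + w.length < k → v.1 i = u.1 j := by
  induction w with
  | nil =>
    refine ⟨0, by simp, by simp, fun i j h _ _ => ?_⟩
    obtain rfl : j = i := Fin.ext (by omega)
    rfl
  | @cons u u' v h p ih =>
    obtain ⟨d, hd, ⟨e, he⟩, ih⟩ := ih
    rw [abs_le] at hd
    simp only [SimpleGraph.Walk.length_cons, Nat.cast_add, Nat.cast_one]
    rcases ((SimpleGraph.fromRel_adj _ _ _).1 h).2 with h | h
    · refine ⟨d + 1, abs_le.2 (by omega), ⟨e, by omega⟩, fun i j hj h₁ h₂ => ?_⟩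
      have hlt : j.1 - 1 < k := by omega
      rw [ih i ⟨j - 1, hlt⟩ (by simp only; omega) (by omega) (by omega)]
      exact h _ _ (by simp only; omega)
    · refine ⟨d - 1, abs_le.2 (by omega), ⟨e - 1, by omega⟩, fun i j hj h₁ h₂ => ?_⟩
      have hlt : j.1 + 1 < k := by omega
      rw [ih i ⟨j + 1, hlt⟩ (by simp only; push_cast; omega) (by omega) (by omega)]
      exact (h _ _ (by simp only)).symm

/-- The entry at position `w.length` is translated to a position inside the tuple. Since the entries
of `u` are distinct, the translation is zero, and it has the parity of the length. -/
theorem shiftGraph_even_of_closed_walk {k N : ℕ} {u : {u : Fin k → Fin N // StrictMono u}}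
    (w : (shiftGraph k N).Walk u u) (hw : 2 * w.length < k) : Even w.length := by
  obtain ⟨d, hd, ⟨e, he⟩, h⟩ := shiftGraph_walk_translates w
  rw [abs_le] at hd
  have h₁ : w.length < k := by omega
  have h₂ : (w.length + d).toNat < k := by omega
  have := u.2.injective (h ⟨_, h₁⟩ ⟨_, h₂⟩ (by simp only; omega) le_rfl (by simp only; omega))
  rw [Fin.mk.injEq] at this
  exact ⟨(-e).toNat, by omega⟩

/-- Shift graphs have arbitrarily large chromatic number: any colouring of increasing `k`-tuples
gives some `(k + 1)`-tuple whose two `k`-tuples of consecutive entries have the same colour. -/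
theorem exists_shift_same_color (k : ℕ) : ∀ (C : Type) [Finite C], ∃ N : ℕ,
    ∀ c : (Fin (k + 1) → Fin N) → C, ∃ l : Fin (k + 2) → Fin N, StrictMono l ∧
      c (l ∘ Fin.castSucc) = c (l ∘ Fin.succ) := by
  induction k with
  | zero =>
    intro C _
    refine ⟨Nat.card C + 1, fun c => ?_⟩
    have hni : ¬ Function.Injective fun x : Fin (Nat.card C + 1) => c fun _ => x := fun hi => by
      have := Nat.card_le_card_of_injective _ hi
      simp at this
    have : ∃ x y : Fin (Nat.card C + 1), x < y ∧ c (fun _ => x) = c fun _ => y := by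
      simp only [Function.Injective, not_forall] at hni
      obtain ⟨x, y, h, hne⟩ := hni
      rcases lt_or_gt_of_ne hne with hlt | hlt
      · exact ⟨x, y, hlt, h⟩
      · exact ⟨y, x, hlt, h.symm⟩
    obtain ⟨x, y, hlt, h⟩ := this
    refine ⟨![x, y], Fin.strictMono_iff_lt_succ.2 fun i => ?_, ?_⟩
    · fin_cases i
      exact hlt
    · convert h using 2
      · funext i; fin_cases i; rfl
      · funext i; fin_cases i; rfl
  | succ k ih =>
    intro C _
    -- Colour a shorter tuple by the set of colours of its increasing one-entry extensions. If both
    -- ends of `l` get the same set, the colour of `l`, an extension of its initial part, is also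
    -- attained by an extension of its final part by some `x`; appending `x` to `l` gives the
    -- required tuple.
    obtain ⟨N, hN⟩ := ih (Set C)
    refine ⟨N, fun c => ?_⟩
    obtain ⟨l, hl, he⟩ := hN fun t =>
      {y | ∃ x, StrictMono (Fin.snoc t x : Fin (k + 2) → Fin N) ∧ c (Fin.snoc t x) = y}
    have hmem : c l ∈ {y | ∃ x, StrictMono (Fin.snoc (l ∘ Fin.castSucc) x : Fin (k + 2) → Fin N) ∧
        c (Fin.snoc (l ∘ Fin.castSucc) x) = y} := by
      have : (Fin.snoc (l ∘ Fin.castSucc) (l (Fin.last _)) : Fin (k + 2) → Fin N) = l :=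
        Fin.snoc_init_self l
      exact ⟨l (Fin.last _), by rwa [this], by rw [this]⟩
    rw [he] at hmem
    obtain ⟨x, hx, hc⟩ := hmem
    have hsucc : (Fin.snoc l x : Fin (k + 3) → Fin N) ∘ Fin.succ = Fin.snoc (l ∘ Fin.succ) x := by
      funext i
      refine Fin.lastCases ?_ (fun j => ?_) i
      · simp only [Function.comp_apply, Fin.succ_last, Fin.snoc_last]
      · simp only [Function.comp_apply, ← Fin.castSucc_succ, Fin.snoc_castSucc]
    refine ⟨Fin.snoc l x, Fin.strictMono_iff_lt_succ.2 fun i => ?_, ?_⟩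
    · have hs := congrFun hsucc i
      rw [Function.comp_apply] at hs
      rw [Fin.snoc_castSucc, hs]
      revert hs
      refine Fin.lastCases ?_ (fun j => ?_) i
      · intro _
        have := hx (Fin.castSucc_lt_last (Fin.last k))
        rwa [Fin.snoc_castSucc, Function.comp_apply, Fin.succ_last] at this
      · intro _
        rw [Fin.snoc_castSucc]
        exact hl Fin.castSucc_lt_succ
    · rw [Fin.snoc_comp_castSucc, hsucc, hc]

theorem exists_shiftGraph_not_colorable (k c : ℕ) : ∃ N, ¬ (shiftGraph (k + 1) N).Colorable c := by
  obtain ⟨N, hN⟩ := exists_shift_same_color k (Option (Fin c))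
  refine ⟨N, fun ⟨C⟩ => ?_⟩
  classical
  -- Tuples that are not increasing are not vertices and get the extra colour `none`.
  obtain ⟨l, hl, he⟩ := hN fun t => if h : StrictMono t then some (C ⟨t, h⟩) else none
  have h₁ : StrictMono (l ∘ Fin.castSucc) := hl.comp Fin.strictMono_castSucc
  have h₂ : StrictMono (l ∘ Fin.succ) := hl.comp Fin.strictMono_succ
  rw [dif_pos h₁, dif_pos h₂, Option.some_inj] at he
  refine C.valid ((SimpleGraph.fromRel_adj _ _ _).2 ⟨fun h => ?_, Or.inl fun i j hj => ?_⟩) he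
  · exact (hl (Fin.castSucc_lt_succ (i := 0))).ne (congrFun (congrArg Subtype.val h) 0)
  · exact congrArg l (Fin.ext (by simp [hj]))

/-- A finite graph with vertex set `Fin N` for some `N`. -/
abbrev FinGraph : Type := Σ N : ℕ, SimpleGraph (Fin N)

/-- There are finite graphs of large chromatic number and large odd girth. -/
theorem exists_finGraph_not_colorable_even_walks (c n : ℕ) : ∃ G : FinGraph, ¬ G.2.Colorable c ∧
    ∀ (u : Fin G.1) (w : G.2.Walk u u), w.length ≤ n → Even w.length := by
  -- The tuples have `2 * n + 1` entries, more than twice the length of any walk under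
  -- consideration.
  obtain ⟨N, hN⟩ := exists_shiftGraph_not_colorable (2 * n) c
  classical
  let e := (shiftGraph (2 * n + 1) N).overFinIso rfl
  refine ⟨⟨_, (shiftGraph (2 * n + 1) N).overFin rfl⟩, fun h => hN (h.of_hom e.toHom),
    fun u w hw => ?_⟩
  have := shiftGraph_even_of_closed_walk (w.map e.symm.toHom)
    (by rw [SimpleGraph.Walk.length_map]; omega)
  rwa [SimpleGraph.Walk.length_map] at this

/-- The homomorphism order on finite graphs has an infinite antichain. -/
theorem exists_finGraph_antichain : ∃ G : ℕ → FinGraph, (∀ n, 0 < (G n).1) ∧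
    ∀ m n, Nonempty ((G m).2 →g (G n).2) → m = n := by
  let r : FinGraph → FinGraph → Prop :=
    fun G H => ¬ Nonempty (G.2 →g H.2) ∧ ¬ Nonempty (H.2 →g G.2)
  have : Std.Symm r := ⟨fun _ _ h => ⟨h.2, h.1⟩⟩
  have hstep : ∀ s : Finset FinGraph, (∀ G ∈ s, ¬ G.2.Colorable 2) →
      ∃ G : FinGraph, ¬ G.2.Colorable 2 ∧ ∀ H ∈ s, r H G := by
    intro s hs
    have hodd : ∀ H : FinGraph, ∃ n, H ∈ s → ∃ (u : Fin H.1) (w : H.2.Walk u u),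
        w.length ≤ n ∧ ¬ Even w.length := by
      intro H
      by_cases hH : H ∈ s
      · have := hs H hH
        rw [SimpleGraph.two_colorable_iff_forall_loop_even] at this
        push Not at this
        obtain ⟨u, w, hw⟩ := this
        exact ⟨w.length, fun _ => ⟨u, w, le_rfl, by simpa using hw⟩⟩
      · exact ⟨0, fun h => absurd h hH⟩
    choose n hn using hodd
    -- A homomorphism from `H` to `G` would carry a short odd closed walk of `H` into `G`; one from
    -- `G` to `H` would colour `G` by the vertices of `H`. The bound `2` keeps the construction
    -- going.
    obtain ⟨G, hc, hw⟩ := exists_finGraph_not_colorable_even_walks (max 2 (s.sup Sigma.fst)) (s.sup n)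
    refine ⟨G, fun h => hc (h.mono (le_max_left _ _)), fun H hH => ⟨?_, ?_⟩⟩
    · rintro ⟨f⟩
      obtain ⟨u, w, hle, hne⟩ := hn H hH
      have := hw _ (w.map f)
      rw [SimpleGraph.Walk.length_map] at this
      exact hne (this (hle.trans (Finset.le_sup hH)))
    · rintro ⟨f⟩
      have h := H.2.colorable_of_fintype.of_hom f
      rw [Fintype.card_fin] at h
      exact hc (h.mono ((Finset.le_sup (f := Sigma.fst) hH).trans (le_max_right _ _)))
  obtain ⟨G, hG, hr⟩ := exists_seq_of_forall_finset_exists' _ r hstep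
  refine ⟨G, fun n => Nat.pos_of_ne_zero fun h0 => hG n ?_, fun m n h => ?_⟩
  · have : IsEmpty (Fin (G n).1) := by rw [h0]; infer_instance
    exact .of_isEmpty 2
  · by_contra hne
    exact (hr hne).1 h

/-! ### Valuations in `B₄` and finitarity of Dunn–Belnap logic -/

/-- The value of a formula in `B₄`: the first component says whether the formula is designated, the
second whether its negation is not. -/
abbrev value (v : ℕ → Bool × Bool) (φ : Fm) : Bool × Bool := matrixB4.eval v φ

section value

variable (v w : ℕ → Bool × Bool) (n : ℕ) (φ ψ : Fm)

@[simp] theorem value_atom : value v (.atom n) = v n := rfl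
@[simp] theorem value_top : value v .top = (true, true) := rfl
@[simp] theorem value_bot : value v .bot = (false, false) := rfl
@[simp] theorem value_neg : value v φ.neg = (!(value v φ).2, !(value v φ).1) := rfl
@[simp] theorem value_and : value v (φ.and ψ) =
    ((value v φ).1 && (value v ψ).1, (value v φ).2 && (value v ψ).2) := rfl
@[simp] theorem value_or : value v (φ.or ψ) =
    ((value v φ).1 || (value v ψ).1, (value v φ).2 || (value v ψ).2) := rfl

theorem value_subst (σ : ℕ → Fm) : value v (φ.subst σ) = value (fun n => value v (σ n)) φ :=
  matrixB4.eval_subst v σ φ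

variable {v w φ}

theorem value_congr (h : ∀ n ∈ φ.atoms, v n = w n) : value v φ = value w φ := by
  induction φ with
  | atom n => exact h n rfl
  | top => rfl
  | bot => rfl
  | neg φ ih => simp only [value_neg, ih h]
  | and φ ψ ih₁ ih₂ =>
    simp only [value_and, ih₁ fun n hn => h n (Or.inl hn), ih₂ fun n hn => h n (Or.inr hn)]
  | or φ ψ ih₁ ih₂ =>
    simp only [value_or, ih₁ fun n hn => h n (Or.inl hn), ih₂ fun n hn => h n (Or.inr hn)]

/-- Valuations are monotone in the information order. -/
theorem value_mono (h : ∀ n, (v n).1 ≤ (w n).1 ∧ (w n).2 ≤ (v n).2) (φ : Fm) :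
    (value v φ).1 ≤ (value w φ).1 ∧ (value w φ).2 ≤ (value v φ).2 := by
  induction φ with
  | atom n => exact h n
  | top => simp
  | bot => simp
  | neg φ ih =>
    simp only [value_neg]
    revert ih
    generalize value v φ = a; generalize value w φ = b
    revert a b; decide
  | and φ ψ ih₁ ih₂ =>
    exact ⟨inf_le_inf ih₁.1 ih₂.1, inf_le_inf ih₁.2 ih₂.2⟩
  | or φ ψ ih₁ ih₂ =>
    exact ⟨sup_le_sup ih₁.1 ih₂.1, sup_le_sup ih₁.2 ih₂.2⟩

/-- If no literals designated by `v` and `w` are opposite, then no formula is designated by `v` while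
its negation is designated by `w`. -/
theorem value_compatible (h : ∀ n, (v n).1 ≤ (w n).2 ∧ (w n).1 ≤ (v n).2) (φ : Fm) :
    (value v φ).1 ≤ (value w φ).2 ∧ (value w φ).1 ≤ (value v φ).2 := by
  induction φ with
  | atom n => exact h n
  | top => simp
  | bot => simp
  | neg φ ih =>
    simp only [value_neg]
    revert ih
    generalize value v φ = a; generalize value w φ = b
    revert a b; decide
  | and φ ψ ih₁ ih₂ =>
    exact ⟨inf_le_inf ih₁.1 ih₂.1, inf_le_inf ih₁.2 ih₂.2⟩
  | or φ ψ ih₁ ih₂ =>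
    exact ⟨sup_le_sup ih₁.1 ih₂.1, sup_le_sup ih₁.2 ih₂.2⟩

/-- Classical valuations give classical values. -/
theorem value_classical (h : ∀ n, (v n).1 = (v n).2) (φ : Fm) : (value v φ).1 = (value v φ).2 := by
  induction φ with
  | atom n => exact h n
  | top => rfl
  | bot => rfl
  | neg φ ih => simp [ih]
  | and φ ψ ih₁ ih₂ | or φ ψ ih₁ ih₂ => simp [ih₁, ih₂]

/-- The value of a formula without atoms does not depend on the valuation and is classical. -/
theorem value_eq_of_atoms_eq_empty (h : φ.atoms = ∅) :
    (∀ v, value v φ = (true, true)) ∨ ∀ v, value v φ = (false, false) := by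
  have hc : ∀ v, value v φ = value (fun _ => (true, true)) φ := fun v =>
    value_congr fun n hn => by simp [h] at hn
  have hv := value_classical (v := fun _ => (true, true)) (fun _ => rfl) φ
  rcases h₂ : (value (fun _ => (true, true)) φ).2
  · exact .inr fun v => by rw [hc, Prod.ext_iff, hv, h₂]; simp
  · exact .inl fun v => by rw [hc, Prod.ext_iff, hv, h₂]; simp

end value

theorem logicB_entails_iff {Γ : Set Fm} {φ : Fm} : logicB.Entails Γ φ ↔
    ∀ v : ℕ → Bool × Bool, (∀ γ ∈ Γ, (value v γ).1 = true) → (value v φ).1 = true := by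
  have h : ∀ a : Bool × Bool, a ∈ ({(true, true), (true, false)} : Set (Bool × Bool)) ↔
      a.1 = true := by
    rintro ⟨_ | _, _ | _⟩ <;> simp
  exact forall_congr' fun v => imp_congr (forall₂_congr fun γ _ => h _) (h _)

theorem logicB_entails_of_mem {Γ : Set Fm} {φ : Fm} (h : φ ∈ Γ) : logicB.Entails Γ φ :=
  logicB_entails_iff.2 fun _ hv => hv _ h

theorem logicB_cut {Γ Φ : Set Fm} {ψ : Fm} (h₁ : ∀ φ ∈ Φ, logicB.Entails Γ φ)
    (h₂ : logicB.Entails Φ ψ) : logicB.Entails Γ ψ :=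
  logicB_entails_iff.2 fun v hv => logicB_entails_iff.1 h₂ v fun φ hφ =>
    logicB_entails_iff.1 (h₁ φ hφ) v hv

theorem logicB_mono {Γ Δ : Set Fm} {φ : Fm} (h : Γ ⊆ Δ) (hφ : logicB.Entails Γ φ) :
    logicB.Entails Δ φ :=
  logicB_cut (fun _ hγ => logicB_entails_of_mem (h hγ)) hφ

theorem continuous_value (φ : Fm) : Continuous fun v : ℕ → Bool × Bool => value v φ := by
  induction φ with
  | atom n => exact continuous_apply n
  | top => exact continuous_const
  | bot => exact continuous_const
  | neg φ ih => exact (continuous_of_discreteTopology (f := fun a : Bool × Bool => (!a.2, !a.1))).comp ih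
  | and φ ψ ih₁ ih₂ =>
    exact (continuous_of_discreteTopology (f := fun a : (Bool × Bool) × (Bool × Bool) =>
      (a.1.1 && a.2.1, a.1.2 && a.2.2))).comp (ih₁.prodMk ih₂)
  | or φ ψ ih₁ ih₂ =>
    exact (continuous_of_discreteTopology (f := fun a : (Bool × Bool) × (Bool × Bool) =>
      (a.1.1 || a.2.1, a.1.2 || a.2.2))).comp (ih₁.prodMk ih₂)

/-- This is compactness of the product space of valuations: designating a given formula, or failing
to, is a closed condition. -/
theorem isFinitary_logicB : logicB.IsFinitary := by
  intro Γ φ h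
  rw [logicB_entails_iff] at h
  have hcl : ∀ (b : Bool) (γ : Fm), IsClosed {v : ℕ → Bool × Bool | (value v γ).1 = b} := fun b γ =>
    isClosed_eq (continuous_fst.comp (continuous_value γ)) continuous_const
  obtain ⟨u, hu⟩ := (hcl false φ).isCompact.elim_finite_subfamily_closed
    (fun γ : Γ => {v | (value v γ.1).1 = true}) (fun γ => hcl true γ.1) (by
      rw [Set.eq_empty_iff_forall_notMem]
      rintro v ⟨hv, hγ⟩
      rw [Set.mem_iInter] at hγ
      have := h v fun γ hm => hγ ⟨γ, hm⟩
      simp_all)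
  refine ⟨Subtype.val '' (u : Set Γ), by simp, u.finite_toSet.image _, ?_⟩
  rw [logicB_entails_iff]
  intro v hv
  by_contra hne
  refine (Set.eq_empty_iff_forall_notMem.1 hu) v ⟨by simpa using hne, ?_⟩
  simp only [Set.mem_iInter]
  exact fun γ hγ => hv _ ⟨γ, hγ, rfl⟩

/-! ### Interpolation for Dunn–Belnap logic -/

/-- The pair of negation normal forms of a formula and of its negation, with all literals whose atom
lies outside of `A` replaced by `⊤`. -/
noncomputable def weaken (A : Set ℕ) : Fm → Fm × Fm
  | .atom n => open Classical in if n ∈ A then (.atom n, .neg (.atom n)) else (.top, .top)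
  | .top => (.top, .bot)
  | .bot => (.bot, .top)
  | .neg φ => (weaken A φ).swap
  | .and φ ψ => (.and (weaken A φ).1 (weaken A ψ).1, .or (weaken A φ).2 (weaken A ψ).2)
  | .or φ ψ => (.or (weaken A φ).1 (weaken A ψ).1, .and (weaken A φ).2 (weaken A ψ).2)

theorem atoms_weaken (A : Set ℕ) (φ : Fm) : (weaken A φ).1.atoms ⊆ φ.atoms ∩ A ∧
    (weaken A φ).2.atoms ⊆ φ.atoms ∩ A := by
  induction φ with
  | atom n => by_cases h : n ∈ A <;> simp [weaken, h, Fm.atoms]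
  | top => simp [weaken, Fm.atoms]
  | bot => simp [weaken, Fm.atoms]
  | neg φ ih => exact ih.symm
  | and φ ψ ih₁ ih₂ | or φ ψ ih₁ ih₂ =>
    simp only [weaken, Fm.atoms, Set.union_inter_distrib_right]
    exact ⟨Set.union_subset_union ih₁.1 ih₂.1, Set.union_subset_union ih₁.2 ih₂.2⟩

-- Replacing the literals of an atom by `⊤` amounts to giving that atom the value `(true, false)`,
-- where both of its literals are designated.
open Classical in
theorem value_weaken (A : Set ℕ) (v : ℕ → Bool × Bool) (φ : Fm) :
    (value v (weaken A φ).1).1 = (value (fun n => if n ∈ A then v n else (true, false)) φ).1 ∧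
    (value v (weaken A φ).2).1 = !(value (fun n => if n ∈ A then v n else (true, false)) φ).2 := by
  induction φ with
  | atom n => by_cases h : n ∈ A <;> simp [weaken, h]
  | top => simp [weaken]
  | bot => simp [weaken]
  | neg φ ih => simp [weaken, ih]
  | and φ ψ ih₁ ih₂ | or φ ψ ih₁ ih₂ => simp [weaken, ih₁, ih₂]

/-- The interpolant is `φ` weakened to the atoms of `ψ`. It follows from `φ` because `(true, false)`
is greatest in the information order, and it entails `ψ` because the modified valuation agrees with
the original one on the atoms of `ψ`. -/
theorem hasInterpolation_logicB : logicB.HasInterpolation := by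
  classical
  intro φ ψ h
  refine ⟨(weaken ψ.atoms φ).1, logicB_entails_iff.2 fun v hv => ?_,
    logicB_entails_iff.2 fun v hv => ?_, (atoms_weaken _ _).1⟩
  · rw [(value_weaken _ _ _).1]
    refine (value_mono (v := v) (fun n => ?_) φ).1 (hv φ rfl)
    split_ifs <;> simp
  · have := hv _ rfl
    rw [(value_weaken _ _ _).1] at this
    rw [logicB_entails_iff] at h
    have := h _ (by simpa using this)
    rwa [value_congr (w := v) fun n hn => if_pos hn] at this

/-! ### Extensions by explosive rules -/

/-- `Γ` is explosive with respect to `E` if it entails a substitution instance of an element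
of `E` in Dunn–Belnap logic. -/
def Explosive (E Γ : Set Fm) : Prop := ∃ ε ∈ E, ∃ σ, logicB.Entails Γ (ε.subst σ)

theorem Explosive.mono {E Γ Δ : Set Fm} (h : Γ ⊆ Δ) : Explosive E Γ → Explosive E Δ :=
  fun ⟨ε, hε, σ, hσ⟩ => ⟨ε, hε, σ, logicB_mono h hσ⟩

/-- The extension of Dunn–Belnap logic in which the explosive sets of formulas entail everything that
they entail together with `A`, for a set of formulas `A` closed under substitutions. -/
def explosiveExtension (E A : Set Fm) (hA : ∀ σ, ∀ α ∈ A, α.subst σ ∈ A) : Logic where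
  Entails Γ φ := logicB.Entails Γ φ ∨ Explosive E Γ ∧ logicB.Entails (Γ ∪ A) φ
  refl φ := .inl (logicB.refl φ)
  mono Γ Δ φ := Or.imp (logicB.mono Γ Δ φ) fun h =>
    ⟨h.1.mono Set.subset_union_left,
      logicB_mono (Set.union_subset_union_left A Set.subset_union_left) h.2⟩
  cut Γ Δ Φ ψ h₁ h₂ := by
    have hA' : ∀ φ ∈ Φ, logicB.Entails (Γ ∪ A) φ := fun φ hφ =>
      (h₁ φ hφ).elim (logicB.mono Γ A φ) And.right
    -- Either all of `Φ` follows from `Γ` in `logicB`, so that explosiveness of the premises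
    -- transfers by cut, or some element of `Φ` does not, and then `Γ` is itself explosive.
    by_cases hB : ∀ φ ∈ Φ, logicB.Entails Γ φ
    · refine h₂.imp (logicB.cut Γ Δ Φ ψ hB) ?_
      rintro ⟨⟨ε, hε, σ, hσ⟩, h⟩
      refine ⟨⟨ε, hε, σ, logicB.cut Γ Δ Φ _ hB hσ⟩, ?_⟩
      rw [Set.union_assoc] at h ⊢
      exact logicB.cut Γ _ Φ ψ hB h
    · push Not at hB
      obtain ⟨φ, hφ, hn⟩ := hB
      have hE := ((h₁ φ hφ).resolve_left hn).1
      refine .inr ⟨hE.mono Set.subset_union_left, ?_⟩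
      have h : logicB.Entails (Φ ∪ (Δ ∪ A)) ψ := by
        rw [← Set.union_assoc]
        exact h₂.elim (logicB.mono _ A ψ) And.right
      refine logicB_mono ?_ (logicB.cut (Γ ∪ A) _ Φ ψ hA' h)
      rintro χ ((h | h) | (h | h)) <;> simp [h]
  structural Γ φ σ := by
    refine Or.imp (logicB.structural Γ φ σ) ?_
    rintro ⟨⟨ε, hε, τ, hτ⟩, h⟩
    refine ⟨⟨ε, hε, fun n => (τ n).subst σ, ?_⟩, ?_⟩
    · have := logicB.structural Γ _ σ hτ
      rw [logicB_entails_iff] at this ⊢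
      simpa only [value_subst] using this
    · refine logicB_mono ?_ (logicB.structural _ φ σ h)
      rw [Set.image_union]
      refine Set.union_subset_union_right _ ?_
      rintro _ ⟨α, hα, rfl⟩
      exact hA σ α hα

section explosiveExtension

variable {E A : Set Fm} {hA : ∀ σ, ∀ α ∈ A, α.subst σ ∈ A}

theorem isSuperBelnap_explosiveExtension : (explosiveExtension E A hA).IsSuperBelnap :=
  fun _ _ => .inl

theorem isFinitary_explosiveExtension : (explosiveExtension E A hA).IsFinitary := by
  rintro Γ φ (h | ⟨⟨ε, hε, σ, hσ⟩, h⟩)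
  · obtain ⟨Γ', hsub, hfin, h⟩ := isFinitary_logicB Γ φ h
    exact ⟨Γ', hsub, hfin, .inl h⟩
  · obtain ⟨Γ₁, hsub₁, hfin₁, h₁⟩ := isFinitary_logicB _ _ hσ
    obtain ⟨Γ₂, hsub₂, hfin₂, h₂⟩ := isFinitary_logicB _ _ h
    refine ⟨Γ₁ ∪ Γ₂ ∩ Γ, Set.union_subset hsub₁ Set.inter_subset_right,
      hfin₁.union (hfin₂.inter_of_left _),
      .inr ⟨⟨ε, hε, σ, logicB_mono Set.subset_union_left h₁⟩, logicB_mono (fun γ hγ => ?_) h₂⟩⟩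
    exact (hsub₂ hγ).elim (fun h => .inl (.inr ⟨hγ, h⟩)) .inr

end explosiveExtension

theorem subst_mem_singleton_bot (σ : ℕ → Fm) : ∀ α ∈ ({.bot} : Set Fm),
    α.subst σ ∈ ({.bot} : Set Fm) := by
  rintro _ rfl
  rfl

/-- The instances of the law of the excluded middle. -/
def excludedMiddle : Set Fm := Set.range fun α : Fm => α.or α.neg

theorem subst_mem_excludedMiddle (σ : ℕ → Fm) : ∀ α ∈ excludedMiddle,
    α.subst σ ∈ excludedMiddle := by
  rintro _ ⟨α, rfl⟩
  exact ⟨α.subst σ, rfl⟩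

/-- The extension of Dunn–Belnap logic by the antiaxioms in `E`. -/
def antiaxiomaticExtension (E : Set Fm) : Logic :=
  explosiveExtension E {.bot} subst_mem_singleton_bot

/-- A consequence already valid in `logicB` keeps its interpolant there; otherwise the premise is
explosive and `⊥`, which has no atoms, interpolates. -/
theorem hasInterpolation_antiaxiomaticExtension (E : Set Fm) :
    (antiaxiomaticExtension E).HasInterpolation := by
  rintro φ ψ (h | ⟨hE, -⟩)
  · obtain ⟨χ, h₁, h₂, h₃⟩ := hasInterpolation_logicB φ ψ h
    exact ⟨χ, .inl h₁, .inl h₂, h₃⟩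
  · refine ⟨.bot, .inr ⟨hE, logicB_entails_of_mem (.inr rfl)⟩,
      .inl (logicB_entails_iff.2 fun v hv => ?_), Set.empty_subset _⟩
    simpa using hv _ rfl

/-- The intersection of the extension of Dunn–Belnap logic by the antiaxioms in `E` with the
extension of Dunn–Belnap logic by the law of the excluded middle. -/
def antiaxiomaticExtensionInfLP (E : Set Fm) : Logic :=
  explosiveExtension E excludedMiddle subst_mem_excludedMiddle

/-! ### Formulas of graphs -/

/-- The formula in disjunctive normal form whose disjuncts are the vertices of a graph, two disjuncts
containing opposite literals if and only if the vertices are not adjacent. -/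
noncomputable def graphFm (G : FinGraph) : Fm :=
  ((List.finRange G.1).map fun i : Fin G.1 => (Fm.atom i).and
    (((List.finRange G.1).map fun j : Fin G.1 => open Classical in
      if G.2.Adj i j then Fm.top else (Fm.atom j).neg).foldr .and .top)).foldr .or .bot

theorem value_foldr_or (v : ℕ → Bool × Bool) (l : List Fm) :
    (value v (l.foldr Fm.or Fm.bot)).1 = true ↔ ∃ φ ∈ l, (value v φ).1 = true := by
  induction l with
  | nil => simp
  | cons φ l ih => simp [ih]

theorem value_foldr_and (v : ℕ → Bool × Bool) (l : List Fm) :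
    (value v (l.foldr Fm.and Fm.top)).1 = true ↔ ∀ φ ∈ l, (value v φ).1 = true := by
  induction l with
  | nil => simp
  | cons φ l ih => simp [ih]

theorem value_graphFm (v : ℕ → Bool × Bool) (G : FinGraph) : (value v (graphFm G)).1 = true ↔
    ∃ i : Fin G.1, (v i).1 = true ∧ ∀ j : Fin G.1, ¬ G.2.Adj i j → (v j).2 = false := by
  have h : ∀ (p : Prop) [Decidable p] (φ : Fm), (value v (if p then Fm.top else φ.neg)).1 = true ↔
      (¬ p → (value v φ).2 = false) := fun p _ φ => by by_cases hp : p <;> simp [hp]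
  simp [graphFm, value_foldr_or, value_foldr_and, h]

/-- An instance of the formula of `H` follows from the formula of `G` only if `G` maps to `H`. -/
theorem nonempty_hom_of_entails {G H : FinGraph} {σ : ℕ → Fm}
    (h : logicB.Entails {graphFm G} ((graphFm H).subst σ)) : Nonempty (G.2 →g H.2) := by
  classical
  rw [logicB_entails_iff] at h
  -- `v i` designates exactly the literals of the disjunct of `i`; the vertex `f i` chosen below
  -- indexes a disjunct of the instance of `graphFm H` that `v i` designates.
  let v : Fin G.1 → ℕ → Bool × Bool := fun i n =>
    (decide (n = i), decide (∀ j : Fin G.1, j = n → G.2.Adj i j))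
  have hv : ∀ i, ∃ k : Fin H.1, (value (v i) (σ k)).1 = true ∧
      ∀ j : Fin H.1, ¬ H.2.Adj k j → (value (v i) (σ j)).2 = false := by
    intro i
    rw [← value_graphFm (fun n => value (v i) (σ n)), ← value_subst]
    refine h _ fun γ hγ => ?_
    rw [Set.mem_singleton_iff.1 hγ, value_graphFm]
    refine ⟨i, by simp [v], fun j hj => ?_⟩
    simp only [v, decide_eq_false_iff_not]
    exact fun hall => hj (hall j rfl)
  choose f hf₁ hf₂ using hv
  refine ⟨⟨f, fun {i i'} hadj => ?_⟩⟩
  by_contra hne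
  -- Disjuncts of adjacent vertices have no opposite literals, so `v i` and `v i'` designate no
  -- opposite formulas. Were `f i` and `f i'` not adjacent, `v i` would designate `σ (f i)` and `v
  -- i'` its negation.
  have hle : ∀ i i', G.2.Adj i i' → ∀ n, (v i n).1 ≤ (v i' n).2 := by
    intro i i' hadj n
    simp only [v, Bool.le_iff_imp, decide_eq_true_eq]
    rintro rfl j hj
    rw [Fin.ext hj]
    exact hadj.symm
  have := (value_compatible (fun n => ⟨hle i i' hadj n, hle i' i hadj.symm n⟩) (σ (f i))).1
  rw [hf₁ i, hf₂ i' (f i) fun h => hne h.symm] at this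
  exact absurd this (by decide)

/-- The formula of a graph with at least one vertex does not entail excluded middle for a new atom. -/
theorem graphFm_not_entails (G : FinGraph) (h : 0 < G.1) :
    ¬ logicB.Entails {graphFm G} ((Fm.atom G.1).or (Fm.atom G.1).neg) := by
  rw [logicB_entails_iff]
  push Not
  -- The new atom has neither literal designated, every other atom has both.
  refine ⟨fun n => (decide (n ≠ G.1), decide (n = G.1)), fun γ hγ => ?_, by simp⟩
  rw [Set.mem_singleton_iff.1 hγ, value_graphFm]
  exact ⟨⟨0, h⟩, by simp [h.ne], fun j _ => by simp [j.2.ne]⟩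

theorem atoms_graphFm (G : FinGraph) : (graphFm G).atoms ⊆ Set.Iio G.1 := by
  have hor : ∀ l : List Fm, (∀ φ ∈ l, φ.atoms ⊆ Set.Iio G.1) →
      (l.foldr Fm.or Fm.bot).atoms ⊆ Set.Iio G.1 ∧ (l.foldr Fm.and Fm.top).atoms ⊆ Set.Iio G.1 := by
    intro l hl
    induction l with
    | nil => exact ⟨Set.empty_subset _, Set.empty_subset _⟩
    | cons φ l ih =>
      have := ih fun φ hφ => hl φ (List.mem_cons_of_mem _ hφ)
      have hφ := hl φ List.mem_cons_self
      exact ⟨Set.union_subset hφ this.1, Set.union_subset hφ this.2⟩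
  refine (hor _ fun φ hφ => ?_).1
  obtain ⟨i, -, rfl⟩ := List.mem_map.1 hφ
  refine Set.union_subset (Set.singleton_subset_iff.2 i.2) (hor _ fun φ hφ => ?_).2
  obtain ⟨j, -, rfl⟩ := List.mem_map.1 hφ
  split_ifs
  · exact Set.empty_subset _
  · exact Set.singleton_subset_iff.2 j.2

/-- No vertex is adjacent to itself, so each disjunct contains an atom together with its negation
and fails at classical valuations. -/
theorem not_explosive_top (S : Set FinGraph) : ¬ Explosive (graphFm '' S) {.top} := by
  rintro ⟨_, ⟨G, -, rfl⟩, σ, h⟩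
  rw [logicB_entails_iff] at h
  have := h (fun _ => (true, true)) (by simp)
  rw [value_subst, value_graphFm] at this
  obtain ⟨i, h₁, h₂⟩ := this
  rw [value_classical (fun _ => rfl), h₂ i (G.2.irrefl)] at h₁
  exact absurd h₁ (by decide)

theorem not_hasInterpolation_antiaxiomaticExtensionInfLP {S : Set FinGraph} {G : FinGraph}
    (hG : G ∈ S) (h0 : 0 < G.1) :
    ¬ (antiaxiomaticExtensionInfLP (graphFm '' S)).HasInterpolation := by
  intro hI
  obtain ⟨χ, h₁, h₂, h₃⟩ := hI (graphFm G) ((Fm.atom G.1).or (Fm.atom G.1).neg)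
    (.inr ⟨⟨_, ⟨G, hG, rfl⟩, Fm.atom, logicB_entails_iff.2 fun v hv => by
      rw [value_subst]; exact hv _ rfl⟩, logicB_entails_of_mem (.inr ⟨_, rfl⟩)⟩)
  have hχ : χ.atoms = ∅ := by
    rw [← Set.subset_empty_iff]
    refine h₃.trans ?_
    rintro n ⟨hn, hn'⟩
    have := atoms_graphFm G hn
    simp only [Fm.atoms, Set.union_self, Set.mem_singleton_iff] at hn'
    exact absurd hn' (ne_of_lt this)
  -- A constantly true `χ` would make excluded middle for the new atom a consequence of `⊤`, or make
  -- `⊤` explosive. A constantly false one would make `graphFm G` inconsistent with excluded middle,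
  -- yet the valuation constantly `(true, false)` designates both.
  rcases value_eq_of_atoms_eq_empty hχ with hv | hv
  · have htop : logicB.Entails {.top} χ := logicB_entails_iff.2 fun v _ => by rw [hv]
    have hcut : ∀ φ, logicB.Entails {χ} φ → logicB.Entails {.top} φ := fun φ =>
      logicB_cut fun γ hγ => by rwa [Set.mem_singleton_iff.1 hγ]
    rcases h₂ with h | ⟨⟨ε, hε, σ, hσ⟩, -⟩
    · have := logicB_entails_iff.1 h (fun _ => (false, true)) (by simp [hv])
      simp at this
    · exact not_explosive_top S ⟨ε, hε, σ, hcut _ hσ⟩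
  · have hLP : logicB.Entails ({graphFm G} ∪ excludedMiddle) χ :=
      h₁.elim (logicB.mono _ _ _) And.right
    have := logicB_entails_iff.1 hLP (fun _ => (true, false)) (by
      rintro γ (hγ | ⟨α, rfl⟩)
      · rw [Set.mem_singleton_iff.1 hγ, value_graphFm]
        exact ⟨⟨0, h0⟩, rfl, fun _ _ => rfl⟩
      -- A classical valuation designates `α` or its negation, and this persists upwards in the
      -- information order.
      · have hα := (value_mono (v := fun _ => (true, true)) (w := fun _ => (true, false))
          (by simp) α)
        have hα' := value_classical (v := fun _ => (true, true)) (fun _ => rfl) α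
        simp only [value_or, value_neg]
        revert hα hα'
        generalize value _ α = a; generalize value _ α = b
        revert a b; decide)
    rw [hv] at this
    exact absurd this (by decide)

/-- Antiaxiomatic extensions given by an antichain of graphs are distinguished by the formulas of
these graphs. -/
theorem mem_iff_entails {G : ℕ → FinGraph} (h0 : ∀ n, 0 < (G n).1)
    (hG : ∀ m n, Nonempty ((G m).2 →g (G n).2) → m = n) (S : Set ℕ) (n : ℕ) {A : Set Fm}
    (hA : ∀ σ, ∀ α ∈ A, α.subst σ ∈ A) (h : ∀ α : Fm, logicB.Entails A (α.or α.neg)) :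
    n ∈ S ↔ (explosiveExtension (graphFm '' (G '' S)) A hA).Entails {graphFm (G n)}
      ((Fm.atom (G n).1).or (Fm.atom (G n).1).neg) := by
  constructor
  · intro hn
    exact .inr ⟨⟨_, ⟨G n, ⟨n, hn, rfl⟩, rfl⟩, Fm.atom, logicB_entails_iff.2 fun v hv => by
      rw [value_subst]; exact hv _ rfl⟩, logicB_mono Set.subset_union_right (h _)⟩
  · rintro (h | ⟨⟨_, ⟨_, ⟨m, hm, rfl⟩, rfl⟩, σ, hσ⟩, -⟩)
    · exact absurd h (graphFm_not_entails _ (h0 n))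
    -- Explosiveness of `graphFm (G n)` is witnessed by some `m ∈ S` and gives a homomorphism from
    -- `G n` to `G m`, so `n = m` by the antichain property.
    · rwa [hG n m (nonempty_hom_of_entails hσ)]

/-! ### Counting the logics -/

/-- An injective coding of formulas by natural numbers. -/
def Fm.code : Fm → ℕ
  | .atom n => Nat.pair 0 n
  | .top => Nat.pair 1 0
  | .bot => Nat.pair 2 0
  | .neg φ => Nat.pair 3 φ.code
  | .and φ ψ => Nat.pair 4 (Nat.pair φ.code ψ.code)
  | .or φ ψ => Nat.pair 5 (Nat.pair φ.code ψ.code)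

theorem Fm.code_injective : Function.Injective Fm.code := by
  intro φ
  induction φ with
  | atom n => intro ψ h; cases ψ <;> simp_all [Fm.code, Nat.pair_eq_pair]
  | top => intro ψ h; cases ψ <;> simp_all [Fm.code, Nat.pair_eq_pair]
  | bot => intro ψ h; cases ψ <;> simp_all [Fm.code, Nat.pair_eq_pair]
  | neg φ ih =>
    intro ψ h
    cases ψ <;> simp [Fm.code, Nat.pair_eq_pair] at h
    rw [ih h]
  | and φ₁ φ₂ ih₁ ih₂ | or φ₁ φ₂ ih₁ ih₂ =>
    intro ψ h
    cases ψ <;> simp [Fm.code, Nat.pair_eq_pair] at h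
    rw [ih₁ h.1, ih₂ h.2]

instance : Countable Fm := Fm.code_injective.countable

theorem mk_finitary_le : Cardinal.mk {L : Logic // L.IsFinitary} ≤ Cardinal.continuum := by
  let f : {L : Logic // L.IsFinitary} → Set (Finset Fm × Fm) := fun L =>
    {p | L.1.Entails (p.1 : Set Fm) p.2}
  have key : ∀ L L' : {L : Logic // L.IsFinitary}, f L = f L' → ∀ Γ φ,
      L.1.Entails Γ φ → L'.1.Entails Γ φ := by
    intro L L' h Γ φ hΓ
    obtain ⟨Γ', hsub, hfin, h'⟩ := L.2 Γ φ hΓ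
    have hmem : (hfin.toFinset, φ) ∈ f L := by simpa [f] using h'
    rw [h] at hmem
    have := L'.1.mono Γ' Γ φ (by simpa [f] using hmem)
    rwa [Set.union_eq_right.2 hsub] at this
  have hf : Function.Injective f := fun L L' h => Subtype.ext <| Logic.ext <| by
    funext Γ φ
    exact propext ⟨key L L' h Γ φ, key L' L h.symm Γ φ⟩
  refine (Cardinal.mk_le_of_injective hf).trans ?_
  rw [Cardinal.mk_set, ← Cardinal.two_power_aleph0]
  exact Cardinal.power_le_power_left two_ne_zero (Cardinal.mk_le_aleph0)

theorem mk_set_nat : Cardinal.mk (Set ℕ) = Cardinal.continuum := by simp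

theorem continuum_le_mk_interpolation : Cardinal.continuum ≤ Cardinal.mk {L : Logic //
    L.IsSuperBelnap ∧ L.IsFinitary ∧ L.HasInterpolation} := by
  obtain ⟨G, h0, hG⟩ := exists_finGraph_antichain
  rw [← mk_set_nat]
  refine Cardinal.mk_le_of_injective (f := fun S => ⟨antiaxiomaticExtension (graphFm '' (G '' S)),
    isSuperBelnap_explosiveExtension, isFinitary_explosiveExtension,
    hasInterpolation_antiaxiomaticExtension _⟩) fun S T h => ?_
  have hbot : ∀ α : Fm, logicB.Entails {.bot} (α.or α.neg) := fun α =>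
    logicB_entails_iff.2 fun v hv => by simpa using hv _ rfl
  ext n
  rw [mem_iff_entails h0 hG S n subst_mem_singleton_bot hbot, mem_iff_entails h0 hG T n subst_mem_singleton_bot hbot]
  exact iff_of_eq (congrArg (fun L : Logic => L.Entails _ _) (congrArg Subtype.val h))

theorem continuum_le_mk_not_interpolation : Cardinal.continuum ≤ Cardinal.mk {L : Logic //
    L.IsSuperBelnap ∧ L.IsFinitary ∧ ¬ L.HasInterpolation} := by
  obtain ⟨G, h0, hG⟩ := exists_finGraph_antichain
  rw [← mk_set_nat]
  -- The graph `G 0` is always included and `S` is shifted by one: for an empty set of graphs the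
  -- logic would be `logicB`, which does have interpolation.
  refine Cardinal.mk_le_of_injective (f := fun S =>
    ⟨antiaxiomaticExtensionInfLP (graphFm '' (G '' insert 0 (Nat.succ '' S))),
    isSuperBelnap_explosiveExtension, isFinitary_explosiveExtension,
    not_hasInterpolation_antiaxiomaticExtensionInfLP ⟨0, Set.mem_insert _ _, rfl⟩ (h0 0)⟩)
    fun S T h => ?_
  have hLP : ∀ α : Fm, logicB.Entails excludedMiddle (α.or α.neg) := fun α =>
    logicB_entails_of_mem ⟨α, rfl⟩
  have hS : ∀ (S : Set ℕ) (n : ℕ), n ∈ S ↔ n + 1 ∈ insert 0 (Nat.succ '' S) := by simp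
  ext n
  rw [hS S, hS T, mem_iff_entails h0 hG _ _ subst_mem_excludedMiddle hLP, mem_iff_entails h0 hG _ _ subst_mem_excludedMiddle hLP]
  exact iff_of_eq (congrArg (fun L : Logic => L.Entails _ _) (congrArg Subtype.val h))

end SuperBelnap

theorem mainTheorem11 :
    Cardinal.continuum ≤
        Cardinal.mk {L : SuperBelnap.Logic // L.IsSuperBelnap ∧ L.HasInterpolation} ∧
      Cardinal.continuum ≤
        Cardinal.mk {L : SuperBelnap.Logic // L.IsSuperBelnap ∧ ¬ L.HasInterpolation} ∧
      Cardinal.mk {L : SuperBelnap.Logic //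
        L.IsSuperBelnap ∧ L.IsFinitary ∧ L.HasInterpolation} = Cardinal.continuum ∧
      Cardinal.mk {L : SuperBelnap.Logic //
        L.IsSuperBelnap ∧ L.IsFinitary ∧ ¬ L.HasInterpolation} = Cardinal.continuum := by
  have h₁ := SuperBelnap.continuum_le_mk_interpolation
  have h₂ := SuperBelnap.continuum_le_mk_not_interpolation
  refine ⟨h₁.trans (Cardinal.mk_subtype_mono fun _ h => ⟨h.1, h.2.2⟩),
    h₂.trans (Cardinal.mk_subtype_mono fun _ h => ⟨h.1, h.2.2⟩), le_antisymm ?_ h₁,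
    le_antisymm ?_ h₂⟩
  · exact (Cardinal.mk_subtype_mono fun _ h => h.2.1).trans SuperBelnap.mk_finitary_le
  · exact (Cardinal.mk_subtype_mono fun _ h => h.2.1).trans SuperBelnap.mk_finitary_le
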